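/- Let $(Q,*)$ be a nonempty idempotent quasigroup, i.e. a nonempty set with a binary operation such that $x*x=x$ for all $x$ and such that for all $a,b\in Q$ there are a unique $x$ with $a*x=b$ (written $x=a\backslash b$) and a unique $y$ with $y*a=b$ (written $y=b/a$). A subquasigroup is a subset closed under $*,\backslash,/$; $\langle X\rangle$ denotes the smallest subquasigroup containing $X$; a subquasigroup is medial if $(x*y)*(u*v)=(x*u)*(y*v)$ for all its elements $x,y,u,v$. Then the following are equivalent: 1. $(Q,*)$ is trimedial, i.e. $\langle a,b,c\rangle$ is medial for all $a,b,c\in Q$; 2. for every $a,b,c,d\in Q$, if $(a*b)*(c*d)=(a*c)*(b*d)$, then the subquasigroup $\langle a,b,c,d\rangle$ is medial; 3. $(Q,*)$ is distributive, i.e. $x*(y*z)=(x*y)*(x*z)$ and $(z*y)*x=(z*x)*(y*x)$ for all $x,y,z\in Q$; 4. $(Q,*)$ is 1-nuclear linear over a commutative Moufang loop, i.e. there are an operation $\cdot$ on $Q$ making $(Q,\cdot)$ a commutative Moufang loop (a quasigroup with a unit element satisfying $xy=yx$ and $((xy)x)z=x(y(xz))$) and automorphisms $\varphi,\psi$ of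 $(Q,\cdot)$ with $\varphi\psi=\psi\varphi$ such that $a*b=\varphi(a)\cdot\psi(b)$ for all $a,b\in Q$, and such that $x\cdot\varphi(x)$ and $x\cdot\psi(x)$ lie in the nucleus $N$ for all $x\in Q$, where $$N=\{a\in Q:\ a(xy)=(ax)y,\ x(ay)=(xa)y,\ x(ya)=(xy)a\ \text{ for all } x,y\in Q\}.$$ -/

import Mathlib

namespace DistQuasigroup

variable {Q : Type*}

/-- `(Q, op)` is a quasigroup: unique left division and unique right division. -/
structure IsQuasigroup (op : Q → Q → Q) : Prop where
  existsUnique_left : ∀ a b, ∃! x, op a x = b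
  existsUnique_right : ∀ a b, ∃! y, op y a = b

/-- Two-sided distributivity. -/
structure IsDistributive (op : Q → Q → Q) : Prop where
  left : ∀ x y z, op x (op y z) = op (op x y) (op x z)
  right : ∀ x y z, op (op z y) x = op (op z x) (op y x)

/-- `S` is a subquasigroup of the quasigroup `(Q, op)`: it is closed under multiplication and both
divisions. The divisions are expressed relationally: `x` with `op a x = b` is `a \ b`, and
`y` with `op y a = b` is `b / a`. -/
structure IsSubquasigroup (op : Q → Q → Q) (S : Set Q) : Prop where
  mul_mem : ∀ {a b}, a ∈ S → b ∈ S → op a b ∈ S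
  ldiv_mem : ∀ {a b x}, a ∈ S → b ∈ S → op a x = b → x ∈ S
  rdiv_mem : ∀ {a b y}, a ∈ S → b ∈ S → op y a = b → y ∈ S

/-- The subquasigroup generated by `X`: the smallest subquasigroup containing `X`. -/
def generated (op : Q → Q → Q) (X : Set Q) : Set Q :=
  ⋂₀ {S | IsSubquasigroup op S ∧ X ⊆ S}

/-- The operation is medial on the subset `S`. -/
def IsMedialOn (op : Q → Q → Q) (S : Set Q) : Prop :=
  ∀ x ∈ S, ∀ y ∈ S, ∀ u ∈ S, ∀ v ∈ S, op (op x y) (op u v) = op (op x u) (op y v)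

/-- Every subquasigroup generated by three elements is medial. -/
def IsTrimedial (op : Q → Q → Q) : Prop :=
  ∀ a b c, IsMedialOn op (generated op {a, b, c})

/-- Whenever four elements mediate, they generate a medial subquasigroup. -/
def MediatingGenerateMedial (op : Q → Q → Q) : Prop :=
  ∀ a b c d, op (op a b) (op c d) = op (op a c) (op b d) →
    IsMedialOn op (generated op {a, b, c, d})

/-- `(Q, mul)` is a loop with unit `e`. -/
structure IsLoop (mul : Q → Q → Q) (e : Q) : Prop extends IsQuasigroup mul where
  one_mul : ∀ a, mul e a = a
  mul_one : ∀ a, mul a e = a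

/-- `(Q, mul)` is a commutative Moufang loop with unit `e`. -/
structure IsCommMoufangLoop (mul : Q → Q → Q) (e : Q) : Prop extends IsLoop mul e where
  comm : ∀ x y, mul x y = mul y x
  moufang : ∀ x y z, mul (mul (mul x y) x) z = mul x (mul y (mul x z))

/-- The nucleus: all elements that associate with all other elements, in every position. -/
def nucleus (mul : Q → Q → Q) : Set Q :=
  {a | ∀ x y, mul a (mul x y) = mul (mul a x) y ∧
    mul x (mul a y) = mul (mul x a) y ∧ mul x (mul y a) = mul (mul x y) a}

/-- `f` is 1-nuclear: `x · f x` is nuclear for every `x`. -/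
def IsOneNuclear (mul : Q → Q → Q) (f : Q → Q) : Prop :=
  ∀ x, mul x (f x) ∈ nucleus mul

/-- The permutation `f` of `Q` is an automorphism of `(Q, mul)`. -/
def IsAutomorphism (mul : Q → Q → Q) (f : Equiv.Perm Q) : Prop :=
  ∀ x y, f (mul x y) = mul (f x) (f y)

/-- `(Q, op)` is linear over `(Q, mul)` with 1-nuclear coefficients: `op a b = φ a · ψ b` for
commuting 1-nuclear automorphisms `φ`, `ψ` of `(Q, mul)`. -/
def IsOneNuclearLinearOver (op mul : Q → Q → Q) : Prop :=
  ∃ φ ψ : Equiv.Perm Q, IsAutomorphism mul φ ∧ IsAutomorphism mul ψ ∧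
    (∀ x, φ (ψ x) = ψ (φ x)) ∧ IsOneNuclear mul φ ∧ IsOneNuclear mul ψ ∧
    ∀ a b, op a b = mul (φ a) (ψ b)

/-- `(Q, op)` is 1-nuclear linear over some commutative Moufang loop on the same set `Q`. -/
def IsOneNuclearLinearOverCML (op : Q → Q → Q) : Prop :=
  ∃ (mul : Q → Q → Q) (e : Q), IsCommMoufangLoop mul e ∧ IsOneNuclearLinearOver op mul

end DistQuasigroup

/-! The substance is the passage from distributivity to a loop. Fix e, let R and L be right and left
translation by e, and put x·y = R⁻¹x * L⁻¹y. Idempotence gives Rx·Lx = x, and distributivity becomes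
x(yz) = (Rx·y)(Lx·z) with its mirror image. The permutations T_x given by xy = T_x(y)·x are
automorphisms, which forces commutativity (`IsSplitLoop.comm`). Then Rx = k·Lx with k nuclear
(`exists_nuclear`), so x = k(Lx)², and cancelling k leaves xx·yz = xy·xz, a form of the Moufang law.
The computation reverses, giving 4 → 3.

For 3 → 2, base the loop at a: mediation of a, b, c, d then says that images of b, c, d associate,
hence that b, c, d do. By Moufang's theorem (`associate_generated`) b, c, d and the nucleus generate
an abelian group; it is stable under R and L because these are 1-nuclear, so * is medial on it. The
steps 2 → 1 → 3 are substitutions. -/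

namespace DistQuasigroup

variable {Q : Type*}

namespace IsQuasigroup

variable {op : Q → Q → Q}

theorem left_cancel (h : IsQuasigroup op) {a x y : Q} (hxy : op a x = op a y) : x = y :=
  (h.existsUnique_left a (op a y)).unique hxy rfl

theorem right_cancel (h : IsQuasigroup op) {a x y : Q} (hxy : op x a = op y a) : x = y :=
  (h.existsUnique_right a (op y a)).unique hxy rfl

/-- Left translation `x ↦ a * x` as a permutation. -/
noncomputable def leftMul (h : IsQuasigroup op) (a : Q) : Equiv.Perm Q :=
  Equiv.ofBijective (op a)
    ⟨fun _ _ hxy => h.left_cancel hxy, fun b => (h.existsUnique_left a b).exists⟩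

/-- Right translation `x ↦ x * a` as a permutation. -/
noncomputable def rightMul (h : IsQuasigroup op) (a : Q) : Equiv.Perm Q :=
  Equiv.ofBijective (fun x => op x a)
    ⟨fun _ _ hxy => h.right_cancel hxy, fun b => (h.existsUnique_right a b).exists⟩

@[simp] theorem leftMul_apply (h : IsQuasigroup op) (a x : Q) : h.leftMul a x = op a x := rfl

@[simp] theorem rightMul_apply (h : IsQuasigroup op) (a x : Q) : h.rightMul a x = op x a := rfl

end IsQuasigroup

theorem IsAutomorphism.map_one {mul : Q → Q → Q} {e : Q} (h : IsLoop mul e) {f : Equiv.Perm Q}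
    (hf : IsAutomorphism mul f) : f e = e := by
  apply h.left_cancel (a := f e)
  rw [← hf, h.one_mul, h.mul_one]

/-! ### Split loops are commutative -/

/-- A loop with automorphisms `R`, `L` such that `x = R x · L x`, for which the idempotent
operation `R x · L y` is distributive. -/
structure IsSplitLoop (mul : Q → Q → Q) (e : Q) (R L : Equiv.Perm Q) : Prop
    extends IsLoop mul e where
  map_mul_R : IsAutomorphism mul R
  map_mul_L : IsAutomorphism mul L
  split : ∀ x, mul (R x) (L x) = x
  mul_mul : ∀ x y z, mul x (mul y z) = mul (mul (R x) y) (mul (L x) z)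
  mul_mul' : ∀ x y z, mul (mul y z) x = mul (mul y (R x)) (mul z (L x))

namespace IsSplitLoop

variable {mul : Q → Q → Q} {e : Q} {R L : Equiv.Perm Q}

/-- The permutation `T x` with `x · y = T x y · x`. -/
noncomputable def conj (h : IsSplitLoop mul e R L) (x : Q) : Equiv.Perm Q :=
  (h.rightMul x)⁻¹ * h.leftMul x

theorem leftMul_eq (h : IsSplitLoop mul e R L) (x : Q) :
    h.leftMul x = h.rightMul x * h.conj x := by
  simp [conj]

theorem conj_mul (h : IsSplitLoop mul e R L) (x y : Q) : mul (h.conj x y) x = mul x y := by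
  have := congrArg (fun f => f y) (h.leftMul_eq x)
  simpa using this.symm

theorem leftMul_split (h : IsSplitLoop mul e R L) (x : Q) :
    h.leftMul x = h.leftMul (R x) * h.leftMul (L x) := by
  ext y
  have := h.mul_mul x e y
  simpa [h.one_mul, h.mul_one] using this

theorem leftMul_split' (h : IsSplitLoop mul e R L) (x : Q) :
    h.leftMul x = h.rightMul (L x) * h.leftMul (R x) := by
  ext y
  have := h.mul_mul x y e
  simpa [h.one_mul, h.mul_one] using this

theorem rightMul_split (h : IsSplitLoop mul e R L) (x : Q) :
    h.rightMul x = h.leftMul (R x) * h.rightMul (L x) := by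
  ext y
  have := h.mul_mul' x e y
  simpa [h.one_mul, h.mul_one] using this

theorem rightMul_split' (h : IsSplitLoop mul e R L) (x : Q) :
    h.rightMul x = h.rightMul (L x) * h.rightMul (R x) := by
  ext y
  have := h.mul_mul' x y e
  simpa [h.one_mul, h.mul_one] using this

/-- The splittings of both translations by x share the left factor `h.leftMul (R x)`, which cancels
in the quotient. -/
theorem conj_L (h : IsSplitLoop mul e R L) (x : Q) : h.conj (L x) = h.conj x := by
  rw [conj, conj, h.leftMul_split x, h.rightMul_split x]; group

theorem conj_R (h : IsSplitLoop mul e R L) (x : Q) : h.conj (R x) = h.conj x := by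
  rw [conj, conj, h.leftMul_split' x, h.rightMul_split' x]; group

/-- Moving Rx and Lx to the right in x(yz) = (Rx·y)(Lx·z) applies the same T_x to both factors; the
mirror law then collects x on the right. -/
theorem isAutomorphism_conj (h : IsSplitLoop mul e R L) (x : Q) :
    IsAutomorphism mul (h.conj x) := fun y z => by
  apply h.right_cancel (a := x)
  rw [h.conj_mul, h.mul_mul' x, ← h.conj_R x, h.conj_mul, h.conj_R x, ← h.conj_L x, h.conj_mul,
    ← h.mul_mul]

theorem conj_self (h : IsSplitLoop mul e R L) (x : Q) : h.conj x x = x :=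
  h.right_cancel (h.conj_mul x x)

theorem commute_rightMul (h : IsSplitLoop mul e R L) {f : Equiv.Perm Q}
    (hf : IsAutomorphism mul f) {x : Q} (hx : f x = x) :
    f * h.rightMul x = h.rightMul x * f := by
  ext y; simp [hf y x, hx]

theorem mul_eq_one_comm (h : IsSplitLoop mul e R L) {x y : Q} (hxy : mul x y = e) :
    mul y x = e := by
  have h1 : h.conj x y = y := by
    apply h.left_cancel (a := x)
    have h2 := h.isAutomorphism_conj x x y
    rw [hxy, (h.isAutomorphism_conj x).map_one h.toIsLoop, h.conj_self] at h2
    rw [hxy, ← h2]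
  rw [← hxy, ← h.conj_mul x y, h1]

theorem conj_inv (h : IsSplitLoop mul e R L) {x y : Q} (hxy : mul x y = e) :
    h.conj y = h.conj x := by
  have hl : (h.leftMul y)⁻¹ = (h.conj x)⁻¹ * h.leftMul x := by
    obtain ⟨w, rfl⟩ := R.surjective x
    have h1 : h.leftMul w * h.leftMul y = h.leftMul (L w) := by
      ext z
      have := h.mul_mul w y z
      rw [hxy, h.one_mul] at this
      simpa using this
    have h2 : h.leftMul w = h.leftMul (L w) * (h.conj (R w))⁻¹ * h.leftMul (R w) := by
      rw [h.leftMul_split' w, h.leftMul_eq (L w), h.conj_L, h.conj_R]; group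
    have h3 : (h.leftMul y)⁻¹ = (h.leftMul (L w))⁻¹ * h.leftMul w := by
      rw [← h1]; group
    rw [h3]
    rw [h2]
    group
  have hr : (h.rightMul y)⁻¹ = h.conj x * h.rightMul x := by
    obtain ⟨w, rfl⟩ := L.surjective x
    have h1 : h.rightMul w * h.rightMul y = h.rightMul (R w) := by
      ext z
      have := h.mul_mul' w z y
      rw [h.mul_eq_one_comm hxy, h.mul_one] at this
      simpa using this
    have h2 : h.rightMul w = h.rightMul (R w) * h.conj (L w) * h.rightMul (L w) := by
      rw [h.rightMul_split w, h.leftMul_eq (R w), h.conj_L, h.conj_R]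
    have h3 : (h.rightMul y)⁻¹ = (h.rightMul (R w))⁻¹ * h.rightMul w := by
      rw [← h1]; group
    rw [h3]
    rw [h2]
    group
  have hc := h.commute_rightMul (h.isAutomorphism_conj x) (h.conj_self x)
  have hl' : h.leftMul y = (h.leftMul x)⁻¹ * h.conj x := by
    rw [← inv_inj, hl]; group
  rw [conj, hr, hl', hc, h.leftMul_eq x]
  group

theorem conj_conj_mul (h : IsSplitLoop mul e R L) (x y : Q) :
    h.conj y (h.conj x (mul y x)) = mul y x := by
  rw [h.isAutomorphism_conj x, h.conj_self, h.conj_mul, h.isAutomorphism_conj y, h.conj_self,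
    h.conj_mul]

/-- The key point: a split loop is commutative. -/
theorem comm (h : IsSplitLoop mul e R L) (x y : Q) : mul x y = mul y x := by
  obtain ⟨x', hx'⟩ := (h.existsUnique_left x e).exists
  -- T_y T_x fixes y·x and depends on y, x only through T_y, T_x, so it fixes both factors of y =
  -- (Ry·x)(Ly·x').
  have h1 : h.conj y (h.conj x (mul (R y) x)) = mul (R y) x := by
    rw [← h.conj_R y, h.conj_conj_mul]
  have h2 : h.conj y (h.conj x (mul (L y) x')) = mul (L y) x' := by
    rw [← h.conj_L y, ← h.conj_inv hx', h.conj_conj_mul]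
  have h3 : mul (mul (R y) x) (mul (L y) x') = y := by
    rw [← h.mul_mul, hx', h.mul_one]
  have h4 : h.conj y (h.conj x y) = y := by
    have h5 : h.conj y (h.conj x (mul (mul (R y) x) (mul (L y) x'))) =
        mul (mul (R y) x) (mul (L y) x') := by
      rw [h.isAutomorphism_conj x, h.isAutomorphism_conj y, h1, h2]
    rwa [h3] at h5
  have h5 : h.conj x y = y := (h.conj y).injective (h4.trans (h.conj_self y).symm)
  rw [← h.conj_mul, h5]

end IsSplitLoop

/-! ### Nucleus and inverse property in commutative loops -/

section CommLoop

variable {mul : Q → Q → Q} {e : Q}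

local infixl:70 " ⬝ " => mul

theorem mem_nucleus_of_comm (hc : ∀ x y, x ⬝ y = y ⬝ x) {a : Q}
    (ha : ∀ x y, a ⬝ (x ⬝ y) = a ⬝ x ⬝ y) : a ∈ nucleus mul := fun x y => by
  refine ⟨ha x y, ?_, ?_⟩
  · rw [hc x (a ⬝ y), ← ha, hc x a, ← ha, hc x y]
  · rw [hc y a, hc x (a ⬝ y), ← ha, hc (x ⬝ y), hc x y]

theorem mul_mem_nucleus (hc : ∀ x y, x ⬝ y = y ⬝ x) {a b : Q} (ha : a ∈ nucleus mul)
    (hb : b ∈ nucleus mul) : a ⬝ b ∈ nucleus mul := by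
  refine mem_nucleus_of_comm hc fun x y => ?_
  rw [← (ha b (x ⬝ y)).1, (hb x y).1, (ha (b ⬝ x) y).1, (ha b x).1]

theorem one_mem_nucleus (h : IsLoop mul e) : e ∈ nucleus mul := fun x y => by
  simp [h.one_mul, h.mul_one]

/-- `inv` is an inverse map for the inverse property. -/
def HasInverseProperty (mul : Q → Q → Q) (inv : Q → Q) : Prop :=
  ∀ x y, mul (inv x) (mul x y) = y ∧ mul x (mul (inv x) y) = y

theorem HasInverseProperty.of_exists (h : IsQuasigroup mul)
    (H : ∀ x, ∃ x', ∀ y, x ⬝ (x' ⬝ y) = y) : ∃ inv, HasInverseProperty mul inv := by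
  choose inv hinv using H
  exact ⟨inv, fun x y => ⟨h.left_cancel (hinv x (x ⬝ y)), hinv x y⟩⟩

theorem HasInverseProperty.inv_mul {inv : Q → Q} (h : HasInverseProperty mul inv)
    (hc : ∀ x y, x ⬝ y = y ⬝ x) (x y : Q) : inv (x ⬝ y) = inv x ⬝ inv y := by
  have h1 : inv (x ⬝ y) ⬝ x = inv y := by
    have h2 : x ⬝ y ⬝ inv y = x := by rw [hc _ (inv y), hc x, (h y x).1]
    have h3 := (h (x ⬝ y) (inv y)).1
    rwa [h2] at h3
  rw [← h1, hc _ x, (h x _).1]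

theorem HasInverseProperty.inv_mem_nucleus {inv : Q → Q} (h : HasInverseProperty mul inv)
    (hq : IsQuasigroup mul) (hc : ∀ x y, x ⬝ y = y ⬝ x) {a : Q} (ha : a ∈ nucleus mul) :
    inv a ∈ nucleus mul :=
  mem_nucleus_of_comm hc fun x y => hq.left_cancel (a := a) <| by
    rw [(h a _).2, (ha _ _).1, (h a x).2]

/-- Apply the middle law to yx and k⁻¹x⁻¹ = (kx)⁻¹: it gives (xy·k)(kx)⁻¹ = y, that is, xy·k = kx·y.
-/
theorem HasInverseProperty.mem_nucleus_of_middle {inv : Q → Q} (h : HasInverseProperty mul inv)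
    (hc : ∀ x y, x ⬝ y = y ⬝ x) {k : Q}
    (hk : ∀ x y, x ⬝ k ⬝ y = x ⬝ (k ⬝ y)) : k ∈ nucleus mul := by
  refine mem_nucleus_of_comm hc fun x y => ?_
  have h1 := hk (y ⬝ x) (inv k ⬝ inv x)
  rw [(h k _).2, hc y x, hc (x ⬝ y) (inv x), (h x y).1, ← h.inv_mul hc, hc _ (inv _)] at h1
  rw [hc k (x ⬝ y), ← (h (k ⬝ x) (x ⬝ y ⬝ k)).2, h1]

/-- In a commutative loop with the inverse property, the identity `xx · yz = xy · xz` is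
equivalent to the Moufang identity. -/
theorem HasInverseProperty.sq_mul_iff {inv : Q → Q} (h : HasInverseProperty mul inv)
    (hc : ∀ x y, x ⬝ y = y ⬝ x) (x : Q) :
    (∀ y z, x ⬝ x ⬝ (y ⬝ z) = x ⬝ y ⬝ (x ⬝ z)) ↔
      ∀ y z, x ⬝ x ⬝ y ⬝ z = x ⬝ (y ⬝ (x ⬝ z)) := by
  have key : ∀ z, x ⬝ inv (x ⬝ z) = inv z := fun z => by rw [h.inv_mul hc, (h x _).2]
  constructor
  · intro H y z
    have h1 := H (y ⬝ (x ⬝ z)) (inv (x ⬝ z))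
    rw [key, hc (y ⬝ _) (inv _), hc y, (h (x ⬝ z) y).1] at h1
    rw [h1, hc _ z, hc _ (inv z), (h z _).2, hc y]
  · intro H y z
    have h1 := H (y ⬝ z) (inv x ⬝ inv z)
    rw [(h x _).2, hc (y ⬝ z), hc y z, (h z y).1] at h1
    rw [hc y z, ← h1, ← h.inv_mul hc, hc _ (inv _), hc _ (x ⬝ z), (h (x ⬝ z) _).2]

/-! ### Commutative Moufang loops and Moufang's theorem -/

theorem IsCommMoufangLoop.exists_inv (h : IsCommMoufangLoop mul e) :
    ∃ inv, HasInverseProperty mul inv := by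
  refine HasInverseProperty.of_exists h.toIsQuasigroup fun x => ?_
  obtain ⟨x', hx'⟩ := (h.existsUnique_left x e).exists
  refine ⟨x', fun z => ?_⟩
  obtain ⟨y, rfl⟩ := (h.existsUnique_left x z).exists
  rw [← h.moufang, hx', h.one_mul]

theorem IsCommMoufangLoop.sq_mul (h : IsCommMoufangLoop mul e) (x y : Q) :
    x ⬝ x ⬝ y = x ⬝ (x ⬝ y) := by
  simpa [h.one_mul, h.mul_one] using h.moufang x e y

theorem IsCommMoufangLoop.sq_mul_mul (h : IsCommMoufangLoop mul e) (x y z : Q) :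
    x ⬝ x ⬝ y ⬝ z = x ⬝ (y ⬝ (x ⬝ z)) := by
  rw [← h.moufang, h.sq_mul, h.comm x (x ⬝ y)]

theorem IsCommMoufangLoop.sq_mul_mul' (h : IsCommMoufangLoop mul e) (x y z : Q) :
    x ⬝ x ⬝ (y ⬝ z) = x ⬝ y ⬝ (x ⬝ z) := by
  obtain ⟨inv, hinv⟩ := h.exists_inv
  exact (hinv.sq_mul_iff h.comm x).2 (h.sq_mul_mul x) y z

theorem IsCommMoufangLoop.of_sq_mul (h : IsLoop mul e) (hc : ∀ x y, x ⬝ y = y ⬝ x)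
    (hs : ∀ x y z, x ⬝ x ⬝ (y ⬝ z) = x ⬝ y ⬝ (x ⬝ z)) {inv : Q → Q}
    (hinv : HasInverseProperty mul inv) : IsCommMoufangLoop mul e where
  toIsLoop := h
  comm := hc
  moufang x y z := by
    have hsq : x ⬝ x ⬝ y = x ⬝ y ⬝ x := by
      have := hs x y e
      rwa [h.mul_one, h.mul_one] at this
    rw [← hsq, (hinv.sq_mul_iff hc x).1 (hs x)]

/-- Both x³·yz and x³y·z reduce to x(xy·xz). -/
theorem IsCommMoufangLoop.cube_mem_nucleus (h : IsCommMoufangLoop mul e) (x : Q) :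
    x ⬝ x ⬝ x ∈ nucleus mul :=
  mem_nucleus_of_comm h.comm fun y z => by
    have hx : ∀ t, x ⬝ x ⬝ x ⬝ t = x ⬝ (x ⬝ x ⬝ t) := fun t => by
      rw [h.sq_mul_mul, h.sq_mul x t]
    rw [hx, hx, h.sq_mul_mul', h.sq_mul x y, ← h.sq_mul x (x ⬝ y), h.sq_mul_mul]

/-- The three elements associate. -/
def Associate (mul : Q → Q → Q) (x y z : Q) : Prop := mul (mul x y) z = mul x (mul y z)

theorem associate_of_mem_nucleus {x y z : Q}
    (H : x ∈ nucleus mul ∨ y ∈ nucleus mul ∨ z ∈ nucleus mul) : Associate mul x y z := by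
  rcases H with H | H | H
  · exact (H y z).1.symm
  · exact (H x z).2.1.symm
  · exact (H x y).2.2.symm

namespace IsCommMoufangLoop

theorem associate_rev (h : IsCommMoufangLoop mul e) {x y z : Q} (H : Associate mul x y z) :
    Associate mul z y x := by
  unfold Associate at *
  rw [h.comm z y, h.comm _ x, ← H, h.comm z, h.comm y x]

/-- The elements associating with `x` and `y` form a subloop, since inner mappings of a commutative
Moufang loop are automorphisms. -/
theorem isSubquasigroup_associate (h : IsCommMoufangLoop mul e) (x y : Q) :
    IsSubquasigroup mul {z | Associate mul x y z} := by
  -- With xx and yy, both bracketings split over a product st. Taking t = e and cancelling xy shows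
  -- that z associates with x, y exactly when it does with xx, yy.
  have hsq : ∀ s t, x ⬝ x ⬝ (y ⬝ y ⬝ (s ⬝ t)) = x ⬝ (y ⬝ s) ⬝ (x ⬝ (y ⬝ t)) := fun s t => by
    rw [h.sq_mul_mul' y, h.sq_mul_mul' x (y ⬝ s)]
  have hsq' : ∀ s t, x ⬝ x ⬝ (y ⬝ y) ⬝ (s ⬝ t) = x ⬝ y ⬝ s ⬝ (x ⬝ y ⬝ t) := fun s t => by
    rw [h.sq_mul_mul', h.sq_mul_mul']
  have hiff : ∀ z, Associate mul x y z ↔ Associate mul (x ⬝ x) (y ⬝ y) z := fun z => by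
    have h1 := hsq z e
    have h2 := hsq' z e
    rw [h.mul_one, h.mul_one] at h1 h2
    unfold Associate
    rw [h1, h2]
    exact ⟨fun H => by rw [H], fun H => h.right_cancel H⟩
  have hdiv : ∀ {s t}, Associate mul x y s → Associate mul x y (s ⬝ t) →
      Associate mul x y t := fun {s t} hs hst => by
    rw [hiff] at hst
    unfold Associate at *
    rw [hsq, hsq', hs] at hst
    exact h.left_cancel hst
  refine ⟨fun {s t} hs ht => ?_, fun {s r t} hs hr hst => ?_, fun {s r t} hs hr hst => ?_⟩
  · refine (hiff _).2 ?_
    have hs : _ = _ := hs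
    have ht : _ = _ := ht
    unfold Associate
    rw [hsq, hsq', hs, ht]
  · subst hst
    exact hdiv hs hr
  · subst hst
    rw [h.comm] at hr
    exact hdiv hs hr

theorem associate_left (h : IsCommMoufangLoop mul e) (x y : Q) : Associate mul x x y :=
  h.sq_mul x y

theorem associate_right (h : IsCommMoufangLoop mul e) (x y : Q) : Associate mul x y y :=
  h.associate_rev (h.associate_left y x)

theorem associate_flexible (h : IsCommMoufangLoop mul e) (x y : Q) : Associate mul x y x := by
  unfold Associate
  rw [h.comm, h.comm y]

/-- Closure under products reaches yy in the last slot; since yyy is nuclear, division yields y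
itself. -/
theorem associate_cycle (h : IsCommMoufangLoop mul e) {x y z : Q} (H : Associate mul x y z) :
    Associate mul z x y := by
  have h1 : Associate mul z y (x ⬝ y) :=
    (h.isSubquasigroup_associate z y).mul_mem (h.associate_rev H) (h.associate_right z y)
  have h2 : Associate mul z x (y ⬝ y) := by
    unfold Associate at *
    rw [h.comm _ (y ⬝ y), h.sq_mul_mul', h.comm y z, h.comm y x, h1, h.comm x (y ⬝ y), h.sq_mul,
      h.comm y x, h.comm y]
  exact (h.isSubquasigroup_associate z x).ldiv_mem h2
    (associate_of_mem_nucleus (.inr (.inr (h.cube_mem_nucleus y)))) rfl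

end IsCommMoufangLoop

theorem subset_generated (X : Set Q) : X ⊆ generated mul X :=
  Set.subset_sInter fun _ hS => hS.2

theorem generated_subset {X S : Set Q} (hS : IsSubquasigroup mul S) (hX : X ⊆ S) :
    generated mul X ⊆ S :=
  Set.sInter_subset_of_mem ⟨hS, hX⟩

theorem isSubquasigroup_generated (X : Set Q) : IsSubquasigroup mul (generated mul X) where
  mul_mem ha hb S hS := hS.1.mul_mem (ha S hS) (hb S hS)
  ldiv_mem ha hb hab S hS := hS.1.ldiv_mem (ha S hS) (hb S hS) hab
  rdiv_mem ha hb hab S hS := hS.1.rdiv_mem (ha S hS) (hb S hS) hab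

namespace IsCommMoufangLoop

/-- Moufang theorem: a set any three of whose elements associate generates an associative subloop. -/
theorem associate_generated (h : IsCommMoufangLoop mul e) {X : Set Q}
    (hX : ∀ x ∈ X, ∀ y ∈ X, ∀ z ∈ X, Associate mul x y z) :
    ∀ x ∈ generated mul X, ∀ y ∈ generated mul X, ∀ z ∈ generated mul X,
      Associate mul x y z := by
  -- Each use enlarges the last slot from X to the generated subloop and rotates it to the front;
  -- three uses fill all slots.
  have step : ∀ {S T : Set Q}, (∀ x ∈ S, ∀ y ∈ T, ∀ z ∈ X, Associate mul x y z) →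
      ∀ z ∈ generated mul X, ∀ x ∈ S, ∀ y ∈ T, Associate mul z x y :=
    fun H z hz x hx y hy => h.associate_cycle
      (generated_subset (h.isSubquasigroup_associate x y) (fun z hz => H x hx y hy z hz) hz)
  exact step (step (step hX))

/-- Three associating elements and the nucleus lie in an associative subloop. -/
theorem exists_associative_subloop (h : IsCommMoufangLoop mul e) {b c d : Q}
    (H : Associate mul b c d) :
    ∃ G : Set Q, IsSubquasigroup mul G ∧ nucleus mul ⊆ G ∧ b ∈ G ∧ c ∈ G ∧ d ∈ G ∧
      ∀ x ∈ G, ∀ y ∈ G, ∀ z ∈ G, Associate mul x y z := by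
  have hsub := subset_generated (mul := mul) ({b, c, d} ∪ nucleus mul)
  refine ⟨generated mul ({b, c, d} ∪ nucleus mul), isSubquasigroup_generated _,
    fun x hx => hsub (.inr hx), hsub (by simp), hsub (by simp), hsub (by simp),
    h.associate_generated fun x hx y hy z hz => ?_⟩
  rcases hx with hx | hx
  · rcases hy with hy | hy
    · rcases hz with hz | hz
      · have h1 := h.associate_cycle H
        have h2 := h.associate_cycle h1
        have h3 := h.associate_rev H
        have h4 := h.associate_rev h1
        have h5 := h.associate_rev h2
        rcases hx with rfl | rfl | rfl <;> rcases hy with rfl | rfl | rfl <;>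
          rcases hz with rfl | rfl | rfl <;>
          first
            | assumption
            | exact h.associate_left _ _
            | exact h.associate_right _ _
            | exact h.associate_flexible _ _
      · exact associate_of_mem_nucleus (.inr (.inr hz))
    · exact associate_of_mem_nucleus (.inr (.inl hy))
  · exact associate_of_mem_nucleus (.inl hx)

end IsCommMoufangLoop

end CommLoop

/-! ### Split loops are Moufang, with 1-nuclear R and L -/

namespace IsSplitLoop

variable {mul : Q → Q → Q} {e : Q} {R L : Equiv.Perm Q}

local infixl:70 " ⬝ " => mul

/-- Write x = Rw with xy = e. Then w(yz) equals both (xy)(Lw·z) = Lw·z and (x·yz)·Lw. -/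
theorem exists_inv (h : IsSplitLoop mul e R L) : ∃ inv, HasInverseProperty mul inv := by
  refine HasInverseProperty.of_exists h.toIsQuasigroup fun x => ?_
  obtain ⟨y, hy⟩ := (h.existsUnique_left x e).exists
  refine ⟨y, fun z => ?_⟩
  obtain ⟨w, rfl⟩ := R.surjective x
  apply h.left_cancel (a := L w)
  have h1 := h.mul_mul w e (y ⬝ z)
  rw [h.one_mul, h.mul_one, h.mul_mul w y z, hy, h.one_mul] at h1
  have h2 := h.mul_mul w (y ⬝ z) e
  rw [h.mul_one, h.mul_one, h.mul_mul w y z, hy, h.one_mul, h.comm _ (L w)] at h2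
  exact h2.symm

/-- The two parts of an element differ by a nuclear factor. -/
theorem exists_nuclear (h : IsSplitLoop mul e R L) (x : Q) :
    ∃ k ∈ nucleus mul, R x = k ⬝ L x := by
  obtain ⟨inv, hinv⟩ := h.exists_inv
  have hswap : ∀ y z, R x ⬝ y ⬝ (L x ⬝ z) = L x ⬝ y ⬝ (R x ⬝ z) := fun y z => by
    rw [← h.mul_mul, h.comm y z, h.mul_mul, h.comm]
  have key : ∀ {y z Y Z}, L x ⬝ Y = R x ⬝ y → R x ⬝ Z = L x ⬝ z → Y ⬝ Z = y ⬝ z :=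
    fun {y z Y Z} hY hZ => h.left_cancel (a := x) <| by
      rw [h.mul_mul, hswap, hY, hZ, ← h.mul_mul]
  obtain ⟨k, hk⟩ := (h.existsUnique_left (L x) (R x)).exists
  obtain ⟨l, hl⟩ := (h.existsUnique_left (R x) (L x)).exists
  have hYl : ∀ Y, R x ⬝ (Y ⬝ l) = L x ⬝ Y := fun Y => by
    obtain ⟨y, hy⟩ := (h.existsUnique_left (R x) (L x ⬝ Y)).exists
    rw [key hy.symm (hl.trans (h.mul_one _).symm), h.mul_one, hy]
  have hkZ : ∀ Z, L x ⬝ (k ⬝ Z) = R x ⬝ Z := fun Z => by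
    obtain ⟨z, hz⟩ := (h.existsUnique_left (L x) (R x ⬝ Z)).exists
    rw [key (hk.trans (h.mul_one _).symm) hz.symm, h.one_mul, hz]
  -- Passing l and k across a product preserves it, and l, k act as mutual inverses; this is the
  -- middle nuclear law for k.
  have hmid : ∀ Y Z, Y ⬝ Z = Y ⬝ l ⬝ (k ⬝ Z) := fun Y Z => key (hYl Y).symm (hkZ Z).symm
  have hlk : ∀ Y, Y ⬝ l ⬝ k = Y := fun Y => by
    have := hmid Y e
    rw [h.mul_one, h.mul_one] at this
    exact this.symm
  refine ⟨k, hinv.mem_nucleus_of_middle h.comm fun y z => ?_, by rw [← hk, h.comm]⟩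
  obtain ⟨Y, rfl⟩ := (h.existsUnique_right l y).exists
  rw [hlk, hmid]

theorem sq_mul (h : IsSplitLoop mul e R L) (x y z : Q) :
    x ⬝ x ⬝ (y ⬝ z) = x ⬝ y ⬝ (x ⬝ z) := by
  obtain ⟨w, rfl⟩ := L.surjective x
  obtain ⟨k, hk, hkw⟩ := h.exists_nuclear w
  have h1 : k ⬝ (L w ⬝ L w) = w := by rw [(hk _ _).1, ← hkw, h.split]
  have h2 := h.mul_mul w y z
  rw [hkw, ← (hk _ _).1, ← (hk _ _).1] at h2
  apply h.left_cancel (a := k)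
  rw [(hk _ _).1, h1, h2]

theorem isCommMoufangLoop (h : IsSplitLoop mul e R L) : IsCommMoufangLoop mul e :=
  let ⟨_, hinv⟩ := h.exists_inv
  .of_sq_mul h.toIsLoop h.comm h.sq_mul hinv

theorem isOneNuclear_L (h : IsSplitLoop mul e R L) : IsOneNuclear mul L := fun x => by
  obtain ⟨k, hk, hkx⟩ := h.exists_nuclear x
  have h1 : x = k ⬝ (L x ⬝ L x) := by rw [(hk _ _).1, ← hkx, h.split]
  have h2 : x ⬝ L x = k ⬝ (L x ⬝ L x ⬝ L x) := by
    rw [(hk _ _).1, ← h1]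
  rw [h2]
  exact mul_mem_nucleus h.comm hk (h.isCommMoufangLoop.cube_mem_nucleus _)

theorem isOneNuclear_R (h : IsSplitLoop mul e R L) : IsOneNuclear mul R := fun x => by
  obtain ⟨k, hk, hkx⟩ := h.exists_nuclear x
  rw [hkx, (hk _ _).2.1, h.comm x k, ← (hk _ _).1]
  exact mul_mem_nucleus h.comm hk (h.isOneNuclear_L x)

end IsSplitLoop

/-! ### Between the quasigroup and its loop -/

section Linear

variable {op mul : Q → Q → Q} {e : Q}

/-- The loop isotope of a distributive quasigroup at the element `e`. -/
theorem IsDistributive.exists_isSplitLoop (hd : IsDistributive op) (hQ : IsQuasigroup op)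
    (hidem : ∀ x, op x x = x) (e : Q) :
    ∃ (mul : Q → Q → Q) (R L : Equiv.Perm Q), IsSplitLoop mul e R L ∧
      (∀ x, R (L x) = L (R x)) ∧ ∀ a b, op a b = mul (R a) (L b) := by
  set R := hQ.rightMul e with hR
  set L := hQ.leftMul e with hL
  have hRL : ∀ x, R (L x) = L (R x) := fun x => by
    simp only [hR, hL, IsQuasigroup.leftMul_apply, IsQuasigroup.rightMul_apply]
    rw [hd.left, hidem]
  have hRop : IsAutomorphism op R := fun x y => hd.right e y x
  have hLop : IsAutomorphism op L := fun x y => hd.left e x y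
  have hRL' : ∀ x, R (L.symm x) = L.symm (R x) := fun x => by
    rw [Equiv.eq_symm_apply, ← hRL, L.apply_symm_apply]
  have hLR' : ∀ x, L (R.symm x) = R.symm (L x) := fun x => by
    rw [Equiv.eq_symm_apply, hRL, R.apply_symm_apply]
  let mul : Q → Q → Q := fun x y => op (R.symm x) (L.symm y)
  have hop : ∀ a b, op a b = mul (R a) (L b) := fun a b => by simp [mul]
  have hRm : IsAutomorphism mul R := fun x y => by
    simp only [mul]; rw [hRop, R.apply_symm_apply, R.symm_apply_apply, hRL']
  have hLm : IsAutomorphism mul L := fun x y => by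
    simp only [mul]; rw [hLop, L.apply_symm_apply, L.symm_apply_apply, hLR']
  have hRe : R.symm e = e := by rw [Equiv.symm_apply_eq]; exact (hidem e).symm
  have hLe : L.symm e = e := by rw [Equiv.symm_apply_eq]; exact (hidem e).symm
  refine ⟨mul, R, L, ⟨⟨⟨fun a b => ?_, fun a b => ?_⟩, fun a => ?_, fun a => ?_⟩, hRm, hLm,
    fun x => by rw [← hop, hidem], fun x y z => ?_, fun x y z => ?_⟩, hRL, hop⟩
  · exact L.symm.bijective.existsUnique_iff.1 (hQ.existsUnique_left (R.symm a) b)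
  · exact R.symm.bijective.existsUnique_iff.1 (hQ.existsUnique_right (L.symm a) b)
  · simp only [mul, hRe]; exact L.apply_symm_apply a
  · simp only [mul, hLe]; exact R.apply_symm_apply a
  · obtain ⟨x, rfl⟩ := R.surjective x
    obtain ⟨y, rfl⟩ := (R.trans L).surjective y
    obtain ⟨z, rfl⟩ := (L.trans L).surjective z
    have := hd.left x y z
    simp only [hop, hRm _ _, hLm _ _, hRL] at this
    simpa [hRL] using this
  · obtain ⟨x, rfl⟩ := L.surjective x
    obtain ⟨y, rfl⟩ := (R.trans R).surjective y
    obtain ⟨z, rfl⟩ := (R.trans L).surjective z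
    have := hd.right x z y
    simp only [hop, hRm _ _, hLm _ _, hRL] at this
    simpa [hRL] using this

theorem IsOneNuclearLinearOver.isDistributive (hm : IsCommMoufangLoop mul e)
    (hlin : IsOneNuclearLinearOver op mul) (hidem : ∀ x, op x x = x) : IsDistributive op := by
  obtain ⟨φ, ψ, hφ, hψ, hcomm, hφn, hψn, hop⟩ := hlin
  obtain ⟨inv, hinv⟩ := hm.exists_inv
  have hsplit : ∀ x, mul (φ x) (ψ x) = x := fun x => by rw [← hop, hidem]
  have hk : ∀ x, ∃ k ∈ nucleus mul, φ x = mul k (ψ x) := fun x => by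
    -- The quotient of the nuclear elements x·φx and x·ψx: the factors x cancel.
    refine ⟨mul (inv (mul x (ψ x))) (mul x (φ x)), mul_mem_nucleus hm.comm
      (hinv.inv_mem_nucleus hm.toIsQuasigroup hm.comm (hψn x)) (hφn x), ?_⟩
    have h1 : mul (mul x (φ x)) (ψ x) = mul (φ x) (mul x (ψ x)) := by
      have h2 : ψ x = mul (inv x) (mul x (ψ x)) := (hinv x _).1.symm
      conv_lhs => rw [h2, (hψn x _ _).2.2, hm.comm _ (inv x), (hinv _ _).1]
    rw [← (hinv.inv_mem_nucleus hm.toIsQuasigroup hm.comm (hψn x) _ _).1, h1, hm.comm (φ x),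
      (hinv _ _).1]
  have key : ∀ x y z, mul x (mul y z) = mul (mul (φ x) y) (mul (ψ x) z) := fun x y z => by
    obtain ⟨k, hk, hkx⟩ := hk x
    have h1 : mul k (mul (ψ x) (ψ x)) = x := by rw [(hk _ _).1, ← hkx, hsplit]
    rw [hkx, ← (hk _ _).1, ← (hk _ _).1, ← hm.sq_mul_mul', (hk _ _).1, h1]
  refine ⟨fun x y z => ?_, fun x y z => ?_⟩
  · simp only [hop, hφ _ _, hψ _ _, hcomm]
    rw [key]
  · simp only [hop, hφ _ _, hψ _ _, hcomm]
    rw [hm.comm _ (ψ x), key, hcomm, hm.comm (ψ (φ x)), hm.comm (ψ (ψ x))]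

/-- A subloop containing the nucleus is closed under `1`-nuclear maps. -/
theorem IsOneNuclear.mem_iff {f : Q → Q} (hf : IsOneNuclear mul f) {G : Set Q}
    (hG : IsSubquasigroup mul G) (hN : nucleus mul ⊆ G) {x : Q} : f x ∈ G ↔ x ∈ G :=
  ⟨fun h => hG.rdiv_mem h (hN (hf x)) rfl, fun h => hG.ldiv_mem h (hN (hf x)) rfl⟩

theorem IsDistributive.mediatingGenerateMedial (hd : IsDistributive op) (hQ : IsQuasigroup op)
    (hidem : ∀ x, op x x = x) : MediatingGenerateMedial op := by
  intro a b c d H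
  -- Basing the loop at a makes a the unit, so it drops out of the mediation identity.
  obtain ⟨mul, R, L, h, hRL, hop⟩ := hd.exists_isSplitLoop hQ hidem a
  have hm := h.isCommMoufangLoop
  have hR := h.isOneNuclear_R
  have hL := h.isOneNuclear_L
  have hNsub : ∀ x y, nucleus mul ⊆ {z | Associate mul x y z} := fun x y z hz =>
    associate_of_mem_nucleus (.inr (.inr hz))
  have hstrip : ∀ {f g : Equiv.Perm Q}, IsOneNuclear mul f → IsOneNuclear mul g → ∀ {x y z},
      Associate mul x y (f (g z)) → Associate mul x y z := fun {f g} hf hg {x y z} hz =>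
    (IsOneNuclear.mem_iff hg (hm.isSubquasigroup_associate x y) (hNsub x y)).1
      ((IsOneNuclear.mem_iff hf (hm.isSubquasigroup_associate x y) (hNsub x y)).1 hz)
  have hRe : R a = a := h.map_mul_R.map_one h.toIsLoop
  have h1 : Associate mul (L (R b)) (L (L d)) (L (R c)) := by
    simp only [hop, h.map_mul_L _ _, hRL, hRe, hm.one_mul] at H
    unfold Associate
    rw [hm.comm _ (L (R c)), hm.comm (L (L d)), H]
  have h2 : Associate mul d c b :=
    hstrip hL hR (hm.associate_cycle (hstrip hL hL (hm.associate_cycle (hstrip hL hR h1))))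
  obtain ⟨G, hG, hN, hdG, hcG, hbG, hassoc⟩ := hm.exists_associative_subloop h2
  have hmemR : ∀ {x}, R x ∈ G ↔ x ∈ G := IsOneNuclear.mem_iff hR hG hN
  have hmemL : ∀ {x}, L x ∈ G ↔ x ∈ G := IsOneNuclear.mem_iff hL hG hN
  have hGop : IsSubquasigroup op G := by
    refine ⟨fun hx hy => ?_, fun hx hy hxy => ?_, fun hx hy hxy => ?_⟩
    · rw [hop]; exact hG.mul_mem (hmemR.2 hx) (hmemL.2 hy)
    · rw [hop] at hxy; exact hmemL.1 (hG.ldiv_mem (hmemR.2 hx) hy hxy)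
    · rw [hop] at hxy; exact hmemR.1 (hG.rdiv_mem (hmemL.2 hx) hy hxy)
  have hsub : generated op {a, b, c, d} ⊆ G := by
    refine generated_subset hGop ?_
    rintro x (rfl | rfl | rfl | rfl)
    exacts [hN (one_mem_nucleus h.toIsLoop), hbG, hcG, hdG]
  have hmed : ∀ p ∈ G, ∀ q ∈ G, ∀ r ∈ G, ∀ s ∈ G,
      mul (mul p q) (mul r s) = mul (mul p r) (mul q s) := fun p hp q hq r hr s hs => by
    rw [hassoc p hp q hq _ (hG.mul_mem hr hs), hassoc p hp r hr _ (hG.mul_mem hq hs),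
      ← hassoc q hq r hr s hs, ← hassoc r hr q hq s hs, hm.comm q r]
  intro x hx y hy u hu v hv
  simp only [hop, h.map_mul_R _ _, h.map_mul_L _ _, hRL]
  exact hmed _ (hmemR.2 (hmemR.2 (hsub hx))) _ (hmemL.2 (hmemR.2 (hsub hy)))
    _ (hmemL.2 (hmemR.2 (hsub hu))) _ (hmemL.2 (hmemL.2 (hsub hv)))

end Linear

end DistQuasigroup

/-! ### The equivalence -/

open DistQuasigroup in
theorem theorem3p3 {Q : Type*} [Nonempty Q] (op : Q → Q → Q)
    (hQ : DistQuasigroup.IsQuasigroup op) (hidem : ∀ x, op x x = x) :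
    List.TFAE [
      DistQuasigroup.IsTrimedial op,
      DistQuasigroup.MediatingGenerateMedial op,
      DistQuasigroup.IsDistributive op,
      DistQuasigroup.IsOneNuclearLinearOverCML op] := by
  tfae_have 1 → 3 := fun h => by
    have hmem : ∀ x y z, x ∈ generated op {x, y, z} ∧ y ∈ generated op {x, y, z} ∧
        z ∈ generated op {x, y, z} := fun x y z =>
      ⟨subset_generated _ (by simp), subset_generated _ (by simp), subset_generated _ (by simp)⟩
    refine ⟨fun x y z => ?_, fun x y z => ?_⟩ <;> obtain ⟨hx, hy, hz⟩ := hmem x y z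
    · have := h x y z x hx x hx y hy z hz
      rwa [hidem] at this
    · have := h x y z z hz y hy x hx x hx
      rwa [hidem] at this
  tfae_have 2 → 1 := fun h a b c => by
    -- Repeating b makes the mediation hypothesis trivial.
    have := h a b b c rfl
    rwa [Set.insert_eq_of_mem (a := b) (by simp)] at this
  tfae_have 3 → 2 := fun h => h.mediatingGenerateMedial hQ hidem
  tfae_have 3 → 4 := fun h => by
    obtain ⟨e⟩ := ‹Nonempty Q›
    obtain ⟨mul, R, L, hs, hRL, hop⟩ := h.exists_isSplitLoop hQ hidem e
    exact ⟨mul, e, hs.isCommMoufangLoop, R, L, hs.map_mul_R, hs.map_mul_L, hRL,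
      hs.isOneNuclear_R, hs.isOneNuclear_L, hop⟩
  tfae_have 4 → 3 := fun ⟨_, _, hm, hlin⟩ => hlin.isDistributive hm hidem
  tfae_finish
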